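/- **Conventions.** A *pointed fibration* is a Serre fibration $p\colon E\to B$ (a continuous map with the homotopy lifting property for all cubes; every Hurewicz fibration is one) with base points $e_0\in E$ and $b_0=p(e_0)\in B$, whose fiber $F=p^{-1}(b_0)$ is pointed by $e_0$, and such that $B$, $E$ and $F$ are path connected. A *section* of $p$ is a continuous map $\sigma\colon B\to E$ with $p\circ\sigma=\mathrm{id}_B$ and $\sigma(b_0)=e_0$. A *homotopically trivial fibration* $(p,r_p)$ is a pointed fibration $p$ together with maps $r_p\colon\pi_i(E)\to\pi_i(F)$, for all $i$, such that $r_p\circ\iota_*=\mathrm{id}$ on $\pi_i(F)$, where $\iota\colon F\to E$ is the inclusion (so $\iota_*$ is injective; $r_p$ need not be a homomorphism). For such a fibration that admits a section and $\alpha\in\pi_i(B)$, the *Berstein–Hilton invariant* is $$H(\alpha,r_p)=\{\,r_p(\sigma_*(\alpha)) : \sigma \text{ a section of } p\,\}\subset\pi_i(F).$$ A homotopically trivial fibration $(p',r_{p'})\colon E'\to B'$ with fiber $F'$ is a *homotopically trivial subfibration* of $(p,r_p)\colon E\to B$ if it is equipped with continuous maps $f_E\colon E'\to E$ and $f_B\colon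 B'\to B$ such that $p\circ f_E=f_B\circ p'$, $f_E$ preserves base points, $f_E$, $f_B$ and the restriction $f_F\colon F'\to F$ of $f_E$ are topological embeddings, and $r_p\circ(f_E)_*=(f_F)_*\circ r_{p'}\colon\pi_i(E')\to\pi_i(F)$ for all $i$. **Theorem.** Let $(p',r_{p'})\colon E'\to B'$ be a homotopically trivial subfibration of a homotopically trivial fibration $(p,r_p)\colon E\to B$. Suppose that $B=B'\cup_\phi D$ is obtained from $B'$ by attaching an $(n+1)$-cell $D$, $n\ge 0$, along a pointed map $\phi\colon S^n\to B'$ representing $\alpha\in\pi_n(B')$, the inclusion $B'\to B$ being $f_B$. Suppose that $p'$ admits a section and that $H(\alpha,r_{p'})$ contains $0$ (the neutral element of $\pi_n(F')$, i.e. the class of the constant map). Then $p$ admits a section. -/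

import Mathlib

open CategoryTheory
open scoped unitInterval Topology Topology.Homotopy

universe u

noncomputable section

/-- A Serre fibration: the homotopy lifting property with respect to all cubes. -/
def IsSerreFibration {E B : Type*} [TopologicalSpace E] [TopologicalSpace B] (p : C(E, B)) :
    Prop :=
  ∀ (k : ℕ) (H : C((Fin k → I) × I, B)) (g : C(Fin k → I, E)),
    (∀ x, p (g x) = H (x, 0)) →
      ∃ G : C((Fin k → I) × I, E), (∀ x, G (x, 0) = g x) ∧ ∀ z, p (G z) = H z

/-- The map `f_* : π_n(X, x) → π_n(Y, y)` induced by a continuous map `f` with `f x = y`. -/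
def piMap (n : ℕ) {X Y : Type*} [TopologicalSpace X] [TopologicalSpace Y] {x : X} {y : Y}
    (f : C(X, Y)) (h : f x = y) : π_ n X x → π_ n Y y :=
  Quotient.map (fun a => ⟨f.comp a.1, fun t ht => (congrArg f (a.2 t ht)).trans h⟩)
    (fun _ _ hab => ContinuousMap.HomotopicRel.comp_continuousMap hab f)

/-- The neutral element of `π_n(X, x)`: the class of the constant map. -/
def piZero (n : ℕ) {X : Type*} [TopologicalSpace X] (x : X) : π_ n X x :=
  Quotient.mk _ GenLoop.const

/-- A pointed fibration `p : E → B`. The base point of `B` is the image of that of `E`, the fibre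
is taken over it and is pointed by the base point of `E`. Base, total space and fibre are
path connected. -/
structure PointedFibration (E B : Type*) [TopologicalSpace E] [TopologicalSpace B] where
  proj : C(E, B)
  pt : E
  isSerreFibration : IsSerreFibration proj
  pathConnected_total : PathConnectedSpace E
  pathConnected_base : PathConnectedSpace B
  pathConnected_fiber : PathConnectedSpace {x : E // proj x = proj pt}

namespace PointedFibration

variable {E B : Type*} [TopologicalSpace E] [TopologicalSpace B]

/-- The base point of the base. -/
def basePt (P : PointedFibration E B) : B := P.proj P.pt

/-- The fibre over the base point. -/
abbrev Fiber (P : PointedFibration E B) : Type _ := {x : E // P.proj x = P.proj P.pt}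

/-- The base point of the fibre. -/
def fiberPt (P : PointedFibration E B) : P.Fiber := ⟨P.pt, rfl⟩

/-- The inclusion of the fibre into the total space. -/
def incl (P : PointedFibration E B) : C(P.Fiber, E) := ⟨Subtype.val, continuous_subtype_val⟩

/-- A pointed section. -/
structure PointedSection (P : PointedFibration E B) where
  toMap : C(B, E)
  proj_toMap : ∀ b, P.proj (toMap b) = b
  map_basePt : toMap P.basePt = P.pt

/-- A homotopically trivial structure on a pointed fibration: for every `i`, a retraction
`r_p : π_i(E) → π_i(F)` of the map `π_i(F) → π_i(E)` induced by the inclusion (which is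
therefore injective). The retraction is not required to be a homomorphism: for a fibration with a
section `σ` the retraction `γ ↦ γ - σ_* p_* γ` need not be one when `i = 1`. -/
structure HomotopicallyTrivial (P : PointedFibration E B) where
  retr : ∀ i : ℕ, π_ i E P.pt → π_ i P.Fiber P.fiberPt
  retr_incl : ∀ (i : ℕ) (y : π_ i P.Fiber P.fiberPt),
    retr i (piMap i P.incl (x := P.fiberPt) (y := P.pt) rfl y) = y

/-- The Berstein-Hilton invariant `H(α, r_p)`: the set of all `r_p (s_* α)`, where `s` ranges over
the pointed sections. -/
def bersteinHilton {P : PointedFibration E B} (r : P.HomotopicallyTrivial) {i : ℕ}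
    (α : π_ i B P.basePt) : Set (π_ i P.Fiber P.fiberPt) :=
  {γ | ∃ s : P.PointedSection, r.retr i (piMap i s.toMap s.map_basePt α) = γ}

variable {E' B' : Type*} [TopologicalSpace E'] [TopologicalSpace B']

/-- A (pointed) map of fibrations. -/
structure Hom (P' : PointedFibration E' B') (P : PointedFibration E B) where
  total : C(E', E)
  base : C(B', B)
  comm : ∀ x, P.proj (total x) = base (P'.proj x)
  map_pt : total P'.pt = P.pt

/-- The component of a map of fibrations on the fibres. -/
def Hom.fiber {P' : PointedFibration E' B'} {P : PointedFibration E B} (f : P'.Hom P) :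
    C(P'.Fiber, P.Fiber) where
  toFun x := ⟨f.total x.1, by rw [f.comm, x.2, ← f.comm, f.map_pt]⟩
  continuous_toFun := by fun_prop

theorem Hom.fiber_fiberPt {P' : PointedFibration E' B'} {P : PointedFibration E B}
    (f : P'.Hom P) : f.fiber P'.fiberPt = P.fiberPt :=
  Subtype.ext f.map_pt

/-- A map of fibrations is a morphism of homotopically trivial fibrations if it commutes with the
retractions. -/
def Hom.IsMorphism {P' : PointedFibration E' B'} {P : PointedFibration E B} (f : P'.Hom P)
    (r' : P'.HomotopicallyTrivial) (r : P.HomotopicallyTrivial) : Prop :=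
  ∀ (i : ℕ) (γ : π_ i E' P'.pt),
    r.retr i (piMap i f.total f.map_pt γ) = piMap i f.fiber f.fiber_fiberPt (r'.retr i γ)

/-- `f` exhibits `(P', r')` as a homotopically trivial subfibration of `(P, r)`: it is a morphism
all of whose components are embeddings. -/
structure Hom.IsSubfibration {P' : PointedFibration E' B'} {P : PointedFibration E B}
    (f : P'.Hom P) (r' : P'.HomotopicallyTrivial) (r : P.HomotopicallyTrivial) : Prop where
  isMorphism : f.IsMorphism r' r
  total : Topology.IsEmbedding f.total
  base : Topology.IsEmbedding f.base
  fiber : Topology.IsEmbedding f.fiber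

end PointedFibration

/-- `q : I^n → S^n` induces a homeomorphism from `I^n / ∂I^n` (for `n = 0`: a point with a disjoint
base point) onto `S^n`, the base point going to `s`. -/
structure IsSphereCollapse {n : ℕ} (q : C(Fin n → I, TopCat.diskBoundary.{u} (n + 1)))
    (s : TopCat.diskBoundary.{u} (n + 1)) : Prop where
  boundary : ∀ y ∈ Cube.boundary (Fin n), q y = s
  bijOn : Set.BijOn q (Cube.boundary (Fin n))ᶜ {s}ᶜ

/-- `φ : S^n → X` is a pointed map representing `α ∈ π_n(X, x)`, for some identification of
`I^n / ∂I^n` with `S^n`. -/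
def RepresentsClass {n : ℕ} {X : Type u} [TopologicalSpace X] {x : X}
    (φ : C(TopCat.diskBoundary.{u} (n + 1), X)) (α : π_ n X x) : Prop :=
  ∃ (s : TopCat.diskBoundary.{u} (n + 1)) (q : C(Fin n → I, TopCat.diskBoundary.{u} (n + 1)))
    (hq : IsSphereCollapse q s) (hs : φ s = x),
    piMap n φ hs (Quotient.mk _ (⟨q, hq.boundary⟩ : GenLoop (Fin n) _ s)) = α

/-- `B = B' ∪_φ D` for a cell `D` of dimension `n + 1` attached along `φ : S^n → B'`, with `j` the
inclusion of `B'`: for some characteristic map `D → B` the square is a pushout of topological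
spaces. -/
def IsCellAttachment {n : ℕ} {B' B : Type u} [TopologicalSpace B'] [TopologicalSpace B]
    (φ : C(TopCat.diskBoundary.{u} (n + 1), B')) (j : C(B', B)) : Prop :=
  ∃ Φ : C(TopCat.disk.{u} (n + 1), B),
    IsPushout (TopCat.diskBoundaryInclusion.{u} (n + 1))
      (TopCat.ofHom φ : TopCat.diskBoundary.{u} (n + 1) ⟶ TopCat.of B')
      (TopCat.ofHom Φ : TopCat.disk.{u} (n + 1) ⟶ TopCat.of B)
      (TopCat.ofHom j : TopCat.of B' ⟶ TopCat.of B)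

end

/-!
A section of `p'` gives a map `τ` on `B'` lifting `B' → B`, and it extends over the cell as soon as
the characteristic map `Φ` of the cell lifts to `E` with `τ ∘ φ` prescribed on the boundary sphere.
Contracting the sphere along its chords to the base point turns `Φ` into a null-homotopy of a
representative of the class of `φ` in `B`, so the question is whether this null-homotopy lifts to a
null-homotopy of the loop `τ ∘ φ` relative to the boundary of the cube. By the relative homotopy
lifting property it lifts to a homotopy from `τ ∘ φ` to a loop `γ` in the fibre. Since `r_p` is a
left inverse of the inclusion of the fibre on homotopy classes, `[γ] = r_p [τ ∘ φ]`, which is the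
image of `r_{p'} (s_* α) = 0`; hence `γ` contracts inside the fibre, and the lift can be chosen to
end at the constant loop.
-/

section HomotopyLifting

variable {E B X Y : Type*} [TopologicalSpace E] [TopologicalSpace B] [TopologicalSpace X]
  [TopologicalSpace Y] {p : C(E, B)}

open ContinuousMap

/-- The homotopy lifting property of `p` relative to `A ⊆ X`, for homotopies that are stationary
on `A`: the lift is required to be stationary on `A` as well. For `A = ∅` this is the homotopy
lifting property with respect to `X`. -/
def HasRelHLP (p : C(E, B)) (A : Set X) : Prop :=
  ∀ (g : C(X, E)) (f : C(X, B)) (K : (p.comp g).HomotopyRel f A),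
    ∃ (g₁ : C(X, E)) (F : g.HomotopyRel g₁ A), ∀ z, p (F z) = K z

theorem IsSerreFibration.hasRelHLP_empty (hp : IsSerreFibration p) (k : ℕ) :
    HasRelHLP p (∅ : Set (Fin k → I)) := by
  intro g f K
  obtain ⟨G, hG₀, hG⟩ := hp k ⟨fun z => K (z.2, z.1), by fun_prop⟩ g
    fun x => (K.apply_zero x).symm
  exact ⟨⟨fun x => G (x, 1), by fun_prop⟩,
    { toFun z := G (z.2, z.1)
      continuous_toFun := by fun_prop
      map_zero_left := hG₀
      map_one_left _ := rfl
      prop' := by simp }, fun z => hG (z.2, z.1)⟩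

theorem HasRelHLP.preimage_homeomorph {A : Set Y} (hp : HasRelHLP p A) (e : X ≃ₜ Y) :
    HasRelHLP p (e ⁻¹' A) := by
  intro g f K
  obtain ⟨g₁, F, hF⟩ := hp (g.comp e.symm) (f.comp e.symm)
    { toFun z := K (z.1, e.symm z.2)
      continuous_toFun := by fun_prop
      map_zero_left y := K.apply_zero _
      map_one_left y := K.apply_one _
      prop' t y hy := K.eq_fst t (by simpa using hy) }
  refine ⟨g₁.comp e,
    { toFun z := F (z.1, e z.2)
      continuous_toFun := by fun_prop
      map_zero_left x := by simp
      map_one_left x := by simp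
      prop' t x hx := by simpa using F.eq_fst t hx }, fun z => ?_⟩
  refine (hF (z.1, e z.2)).trans (congrArg K ?_)
  simp

/-- Lift the homotopy `f ∘ D`, which starts in `A`, and read off its value at the time `ζ y` when
the deformation has returned to `y`; on `A` that is the initial time. -/
theorem HasRelHLP.exists_lift_of_deformation {A : Set Y} (hp : HasRelHLP p (∅ : Set Y))
    (D : C(I × Y, Y)) (ζ : C(Y, I)) (hD : ∀ y, D (0, y) ∈ A) (hDζ : ∀ y, D (ζ y, y) = y)
    (hζ : ∀ y ∈ A, ζ y = 0) (f : C(Y, B)) (g : C(A, E)) (hg : ∀ a : A, p (g a) = f a) :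
    ∃ G : C(Y, E), (∀ a : A, G a = g a) ∧ ∀ y, p (G y) = f y := by
  obtain ⟨_, F, hF⟩ := hp (g.comp ⟨fun y => ⟨D (0, y), hD y⟩, by fun_prop⟩)
    (f.comp ⟨fun y => D (1, y), by fun_prop⟩)
    { toFun z := f (D z)
      continuous_toFun := by fun_prop
      map_zero_left y := (hg ⟨_, hD y⟩).symm
      map_one_left _ := rfl
      prop' := by simp }
  refine ⟨⟨fun y => F (ζ y, y), by fun_prop⟩, fun a => ?_, fun y => ?_⟩
  · have hDa : D (0, a) = a := by rw [← hζ a a.2, hDζ]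
    calc F (ζ a, a) = F (0, a) := by rw [hζ a a.2]
      _ = g ⟨D (0, a), hD a⟩ := F.apply_zero _
      _ = g a := congrArg g (Subtype.ext hDa)
  · exact (hF _).trans (congrArg f (hDζ y))

end HomotopyLifting

section Box

variable {N : Type*}

/-- The subset `{0} × I^N ∪ I × ∂I^N` of the box `I × I^N`. -/
def openBox (N : Type*) : Set (I × (N → I)) := {z | z.1 = 0 ∨ z.2 ∈ Cube.boundary N}

/-- The homothety of ratio `c` with centre `(2, midpoint)`, truncated to the box. -/
noncomputable def boxHomothety (c : ℝ) (z : I × (N → I)) : I × (N → I) :=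
  (Set.projIcc 0 1 zero_le_one (2 - c * (2 - z.1)),
    fun i => Set.projIcc 0 1 zero_le_one ((c * (2 * z.2 i - 1) + 1) / 2))

theorem continuous_boxHomothety :
    Continuous fun w : ℝ × (I × (N → I)) => boxHomothety w.1 w.2 := by
  refine Continuous.prodMk (continuous_projIcc.comp ?_)
    (continuous_pi fun i => continuous_projIcc.comp ?_) <;> fun_prop

theorem boxHomothety_one (z : I × (N → I)) : boxHomothety 1 z = z := by
  simp [boxHomothety]

variable [Fintype N]

/-- The sup norm of a point of the cube in coordinates centred at the midpoint and scaled to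
`[-1, 1]`. -/
noncomputable def cubeNorm (y : N → I) : ℝ := ‖fun i => 2 * (y i : ℝ) - 1‖

theorem continuous_cubeNorm : Continuous (cubeNorm (N := N)) := by
  unfold cubeNorm
  fun_prop

theorem cubeNorm_le_one (y : N → I) : cubeNorm y ≤ 1 := by
  refine (pi_norm_le_iff_of_nonneg zero_le_one).2 fun i => ?_
  rw [Real.norm_eq_abs, abs_le]
  constructor <;> linarith [(y i).2.1, (y i).2.2]

theorem cubeNorm_eq_one_of_mem_boundary {y : N → I} (hy : y ∈ Cube.boundary N) :
    cubeNorm y = 1 := by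
  obtain ⟨i, hi⟩ := hy
  refine (cubeNorm_le_one y).antisymm (le_trans ?_ (norm_le_pi_norm _ i))
  rcases hi with hi | hi <;> norm_num [hi]

theorem exists_abs_eq_cubeNorm {y : N → I} (hy : 0 < cubeNorm y) :
    ∃ i, |2 * (y i : ℝ) - 1| = cubeNorm y := by
  have : Nonempty N := by
    by_contra h
    rw [not_nonempty_iff] at h
    simp [cubeNorm, Subsingleton.elim _ (0 : N → ℝ)] at hy
  exact (IsGreatest.pi_norm fun i => 2 * (y i : ℝ) - 1).1

/-- The ratio of the homothety with centre `(2, midpoint)`, a point above the box, that moves `z`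
into `openBox N`. -/
noncomputable def boxRatio (z : I × (N → I)) : ℝ := (max (cubeNorm z.2) (1 - (z.1 : ℝ) / 2))⁻¹

theorem inv_boxRatio_mem_Icc (z : I × (N → I)) : (boxRatio z)⁻¹ ∈ Set.Icc (1 / 2 : ℝ) 1 := by
  rw [boxRatio, inv_inv]
  exact ⟨le_max_of_le_right (by linarith [z.1.2.2]),
    max_le (cubeNorm_le_one _) (by linarith [z.1.2.1])⟩

theorem boxRatio_pos (z : I × (N → I)) : 0 < boxRatio z :=
  inv_pos.1 (one_half_pos.trans_le (inv_boxRatio_mem_Icc z).1)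

theorem boxRatio_mem_Icc (z : I × (N → I)) : boxRatio z ∈ Set.Icc (1 : ℝ) 2 := by
  obtain ⟨h₁, h₂⟩ := inv_boxRatio_mem_Icc z
  exact ⟨(inv_le_one₀ (boxRatio_pos z)).1 h₂,
    (inv_le_inv₀ two_pos (boxRatio_pos z)).1 (by simpa using h₁)⟩

theorem continuous_boxRatio : Continuous (boxRatio (N := N)) := by
  have hnorm := continuous_cubeNorm (N := N)
  refine Continuous.inv₀ (by fun_prop) fun z => ?_
  simpa only [boxRatio, inv_inv] using (inv_pos.2 (boxRatio_pos z)).ne'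

theorem boxRatio_eq_one {z : I × (N → I)} (hz : z ∈ openBox N) : boxRatio z = 1 := by
  rw [boxRatio, inv_eq_one]
  rcases hz with hz | hz
  · simpa [hz] using cubeNorm_le_one z.2
  · rw [cubeNorm_eq_one_of_mem_boundary hz, max_eq_left]
    linarith [z.1.2.1]

theorem boxHomothety_boxRatio_mem_openBox (z : I × (N → I)) :
    boxHomothety (boxRatio z) z ∈ openBox N := by
  have hpos := boxRatio_pos z
  rcases max_choice (cubeNorm z.2) (1 - (z.1 : ℝ) / 2) with h | h
  · right
    have hinv : cubeNorm z.2 = (boxRatio z)⁻¹ := by rw [boxRatio, inv_inv, h]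
    obtain ⟨i, hi⟩ := exists_abs_eq_cubeNorm (hinv ▸ inv_pos.2 hpos)
    refine ⟨i, ?_⟩
    rcases eq_or_eq_neg_of_abs_eq (hi.trans hinv) with h' | h'
    · right
      refine Set.projIcc_of_right_le zero_le_one ?_
      norm_num [h', hpos.ne']
    · left
      refine Set.projIcc_of_le_left zero_le_one ?_
      norm_num [h', hpos.ne']
  · left
    have hinv : 2 - (z.1 : ℝ) = 2 * (boxRatio z)⁻¹ := by rw [boxRatio, inv_inv, h]; ring
    refine Set.projIcc_of_le_left zero_le_one ?_
    rw [hinv, mul_left_comm, mul_inv_cancel₀ hpos.ne']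
    norm_num

/-- The points of the box moved back from `openBox N` along the rays through `(2, midpoint)`, until
they reach their original position. -/
noncomputable def boxDeformation (N : Type*) [Fintype N] : C(I × (I × (N → I)), I × (N → I)) where
  toFun w := boxHomothety (max 1 (boxRatio w.2 - w.1)) w.2
  continuous_toFun := by
    have hratio := continuous_boxRatio (N := N)
    exact continuous_boxHomothety.comp (by fun_prop :
      Continuous fun w : I × (I × (N → I)) => (max 1 (boxRatio w.2 - w.1), w.2))

theorem boxDeformation_zero_mem (z : I × (N → I)) : boxDeformation N (0, z) ∈ openBox N := by
  have hmax : max 1 (boxRatio z - (0 : I)) = boxRatio z := by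
    simpa using (boxRatio_mem_Icc z).1
  change boxHomothety (max 1 (boxRatio z - (0 : I))) z ∈ openBox N
  rw [hmax]
  exact boxHomothety_boxRatio_mem_openBox z

/-- The time at which `boxDeformation` has moved a point back to its original position. -/
noncomputable def boxTime (N : Type*) [Fintype N] : C(I × (N → I), I) where
  toFun z := ⟨boxRatio z - 1, by linarith [(boxRatio_mem_Icc z).1],
    by linarith [(boxRatio_mem_Icc z).2]⟩
  continuous_toFun := (continuous_boxRatio.sub continuous_const).subtype_mk _

theorem boxDeformation_boxTime (z : I × (N → I)) : boxDeformation N (boxTime N z, z) = z := by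
  have hmax : max 1 (boxRatio z - boxTime N z) = 1 := by simp [boxTime]
  exact (congrArg (boxHomothety · z) hmax).trans (boxHomothety_one z)

theorem boxTime_eq_zero {z : I × (N → I)} (hz : z ∈ openBox N) : boxTime N z = 0 :=
  Subtype.ext (by simp [boxTime, boxRatio_eq_one hz])

end Box

section Cylinder

open ContinuousMap

variable {E B X : Type*} [TopologicalSpace E] [TopologicalSpace B] [TopologicalSpace X]
  {p : C(E, B)}

theorem HasRelHLP.boundary {N : Type*} [Finite N] (hp : HasRelHLP p (∅ : Set (I × (N → I)))) :
    HasRelHLP p (Cube.boundary N) := by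
  have := Fintype.ofFinite N
  intro g f K
  obtain ⟨G, hGg, hG⟩ := hp.exists_lift_of_deformation (boxDeformation N) (boxTime N)
    boxDeformation_zero_mem boxDeformation_boxTime (fun _ => boxTime_eq_zero) K.toContinuousMap
    (g.comp ⟨fun a : openBox N => a.1.2, by fun_prop⟩) <| by
      rintro ⟨⟨t, y⟩, ht | hy⟩
      · obtain rfl : t = 0 := ht
        exact (K.apply_zero y).symm
      · exact (K.eq_fst t hy).symm
  exact ⟨⟨fun y => G (1, y), by fun_prop⟩,
    { toContinuousMap := G
      map_zero_left y := hGg ⟨(0, y), Or.inl rfl⟩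
      map_one_left _ := rfl
      prop' t y hy := hGg ⟨(t, y), Or.inr hy⟩ }, hG⟩

/-- The boundary `∂I × X ∪ I × A` of the cylinder on the pair `(X, A)`. -/
def cylinderBoundary (A : Set X) : Set (I × X) := {z | z.1 = 0 ∨ z.1 = 1 ∨ z.2 ∈ A}

/-- The identification of the cylinder `I × I^k` with the cube `I^(k + 1)`. -/
def cylinderHomeomorphCube (k : ℕ) : I × (Fin k → I) ≃ₜ (Fin (k + 1) → I) where
  toEquiv := Fin.consEquiv fun _ => I
  continuous_toFun := Continuous.finCons (A := fun _ => I) continuous_fst continuous_snd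
  continuous_invFun := (continuous_apply 0).prodMk (continuous_pi fun i => continuous_apply i.succ)

theorem preimage_cylinderHomeomorphCube_boundary (k : ℕ) :
    cylinderHomeomorphCube k ⁻¹' Cube.boundary (Fin (k + 1)) =
      cylinderBoundary (Cube.boundary (Fin k)) := by
  ext z
  change (∃ i, Fin.cons (α := fun _ => I) z.1 z.2 i = 0 ∨
    Fin.cons (α := fun _ => I) z.1 z.2 i = 1) ↔ _
  simp only [Fin.exists_fin_succ, Fin.cons_zero, Fin.cons_succ, or_assoc]
  rfl

theorem IsSerreFibration.hasRelHLP_boundary (hp : IsSerreFibration p) (k : ℕ) :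
    HasRelHLP p (Cube.boundary (Fin k)) :=
  ((hp.hasRelHLP_empty (k + 1)).preimage_homeomorph (cylinderHomeomorphCube k)).boundary

theorem IsSerreFibration.hasRelHLP_cylinderBoundary (hp : IsSerreFibration p) (k : ℕ) :
    HasRelHLP p (cylinderBoundary (Cube.boundary (Fin k))) :=
  preimage_cylinderHomeomorphCube_boundary k ▸
    (hp.hasRelHLP_boundary (k + 1)).preimage_homeomorph (cylinderHomeomorphCube k)

/-- A homotopy from `t ↦ min 1 (2 * t)`, the time change in `K.trans refl`, to the identity,
relative to the endpoints. -/
noncomputable def timeChange : C(I × I, I) where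
  toFun z := Set.projIcc 0 1 zero_le_one ((2 - z.1) * z.2)
  continuous_toFun := continuous_projIcc.comp (by fun_prop)

theorem timeChange_zero_right (u : I) : timeChange (u, 0) = 0 :=
  Set.projIcc_of_le_left zero_le_one (by simp)

theorem timeChange_one_right (u : I) : timeChange (u, 1) = 1 :=
  Set.projIcc_of_right_le zero_le_one (by simpa using (by linarith [u.2.2] : (1 : ℝ) ≤ 2 - u))

theorem timeChange_one_left (t : I) : timeChange (1, t) = t := by
  have h : (2 - ((1 : I) : ℝ)) * t = t := by norm_num
  exact (congrArg _ h).trans (Set.projIcc_val zero_le_one t)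

theorem trans_refl_apply {f₀ f₁ : C(X, B)} {A : Set X} (K : f₀.HomotopyRel f₁ A)
    (t : I) (x : X) :
    K.trans (HomotopyRel.refl f₁ A) (t, x) = K (timeChange (0, t), x) := by
  rw [HomotopyRel.trans_apply]
  split_ifs with ht
  · have h : (timeChange (0, t) : ℝ) = 2 * t := by
      simp [timeChange, Set.coe_projIcc, min_eq_right (by linarith : 2 * (t : ℝ) ≤ 1), t.2.1]
    exact congrArg (fun s => K (s, x)) (Subtype.ext h.symm)
  · have h : timeChange (0, t) = 1 := Set.projIcc_of_right_le zero_le_one (by simp; linarith)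
    rw [h, K.apply_one]
    rfl

theorem homotopicRel_trans_refl {f₀ f₁ : C(X, B)} {A : Set X} (K : f₀.HomotopyRel f₁ A) :
    (K.trans (HomotopyRel.refl f₁ A)).toContinuousMap.HomotopicRel K.toContinuousMap
      (cylinderBoundary A) := by
  refine ⟨{ toFun w := K (timeChange (w.1, w.2.1), w.2.2)
            continuous_toFun := by fun_prop
            map_zero_left z := (trans_refl_apply K z.1 z.2).symm
            map_one_left z := by rw [timeChange_one_left]; rfl
            prop' := ?_ }⟩
  rintro u ⟨t, x⟩ hz
  refine Eq.trans ?_ (trans_refl_apply K t x).symm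
  rcases hz with ht | ht | hx
  · obtain rfl : t = 0 := ht
    simp [timeChange_zero_right]
  · obtain rfl : t = 1 := ht
    simp [timeChange_one_right]
  · exact (K.eq_fst _ hx).trans (K.eq_fst _ hx).symm

/-- `F.trans L` lifts `K.trans refl` instead of `K`; lifting the reparametrization homotopy from
`K.trans refl` to `K` relative to the boundary of the cylinder corrects this. -/
theorem HasRelHLP.exists_lift_trans_vertical {A : Set X} (hp : HasRelHLP p (cylinderBoundary A))
    {g g₁ g₂ : C(X, E)} {f : C(X, B)} (K : (p.comp g).HomotopyRel f A) (F : g.HomotopyRel g₁ A)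
    (hF : ∀ z, p (F z) = K z) (L : g₁.HomotopyRel g₂ A) (hL : ∀ t x, p (L (t, x)) = f x) :
    ∃ W : g.HomotopyRel g₂ A, ∀ z, p (W z) = K z := by
  obtain ⟨H⟩ := homotopicRel_trans_refl K
  have hM : p.comp (F.trans L).toContinuousMap =
      (K.trans (HomotopyRel.refl f A)).toContinuousMap := by
    ext z
    change p ((F.trans L) z) = (K.trans (HomotopyRel.refl f A)) z
    rw [HomotopyRel.trans_apply, HomotopyRel.trans_apply]
    split_ifs
    · exact hF _
    · exact hL _ _
  obtain ⟨W, R, hR⟩ := hp (F.trans L).toContinuousMap K.toContinuousMap (H.cast hM.symm rfl)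
  have hW : ∀ z ∈ cylinderBoundary A, W z = F.trans L z := fun z hz =>
    (R.apply_one z).symm.trans (R.eq_fst 1 hz)
  refine ⟨{ toContinuousMap := W
            map_zero_left x := (hW _ (Or.inl rfl)).trans ((F.trans L).apply_zero x)
            map_one_left x := (hW _ (Or.inr (Or.inl rfl))).trans ((F.trans L).apply_one x)
            prop' t x hx := (hW _ (Or.inr (Or.inr hx))).trans ((F.trans L).eq_fst t hx) },
    fun z => ?_⟩
  calc p (W z) = p (R (1, z)) := by rw [R.apply_one]
    _ = H (1, z) := hR (1, z)
    _ = K z := H.apply_one z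

end Cylinder

section Chords

open AffineMap EuclideanGeometry

variable {V P : Type*} [NormedAddCommGroup V] [InnerProductSpace ℝ V] [MetricSpace P]
  [NormedAddTorsor V P] {S : Sphere P} {p : P}

theorem secondInter_lineMap_vsub {x : P} (hp : p ∈ S) (hx : x ∈ S) {t : ℝ} (ht : t ≠ 1) :
    S.secondInter p (lineMap x p t -ᵥ p) = x := by
  rw [lineMap_vsub_right, S.secondInter_smul p _ (sub_ne_zero.2 ht.symm)]
  rcases (S.eq_or_eq_secondInter_iff_mem_of_mem_affineSpan_pair hp
    (right_mem_affineSpan_pair ℝ p x)).2 hx with rfl | h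
  · rw [vsub_self, Sphere.secondInter_zero]
  · exact h.symm

theorem eq_and_eq_of_lineMap_eq_lineMap {x x' : P} (hp : p ∈ S) (hx : x ∈ S) (hx' : x' ∈ S)
    (hxp : x ≠ p) {t t' : ℝ} (ht : t ≠ 1) (ht' : t' ≠ 1)
    (h : lineMap x p t = lineMap x' p t') : t = t' ∧ x = x' := by
  obtain rfl : x = x' := by
    rw [← secondInter_lineMap_vsub hp hx ht, h, secondInter_lineMap_vsub hp hx' ht']
  exact ⟨lineMap_injective ℝ hxp h, rfl⟩

theorem exists_lineMap_eq_of_dist_le (hp : p ∈ S) {d : P} (hd : dist d S.center ≤ S.radius) :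
    ∃ x ∈ S, ∃ t ∈ Set.Icc (0 : ℝ) 1, lineMap x p t = d :=
  ⟨_, (Sphere.secondInter_mem _).2 hp, (Sphere.wbtw_secondInter hp hd).symm⟩

end Chords

section DiskCone

open AffineMap
open TopCat (disk diskBoundary diskBoundaryInclusion)

variable {n : ℕ} (s : diskBoundary.{u} n)

/-- The disk as a cone on its boundary sphere with apex at the boundary point `s`: the point `x`
of the sphere is joined to `s` by a chord. -/
noncomputable def diskCone : C(I × diskBoundary.{u} n, disk.{u} n) where
  toFun z := ⟨⟨lineMap z.2.down.1 s.down.1 (z.1 : ℝ),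
    (convex_closedBall _ _).lineMap_mem (Metric.sphere_subset_closedBall z.2.down.2)
      (Metric.sphere_subset_closedBall s.down.2) z.1.2⟩⟩
  continuous_toFun := by
    simp only [lineMap_apply_module]
    refine continuous_uliftUp.comp (Continuous.subtype_mk ?_ _)
    fun_prop

theorem diskCone_zero (x : diskBoundary.{u} n) :
    diskCone s (0, x) = diskBoundaryInclusion n x :=
  ULift.ext _ _ (Subtype.ext (lineMap_apply_zero _ _))

theorem diskCone_eq_apex_iff {z : I × diskBoundary.{u} n} :
    diskCone s z = diskBoundaryInclusion n s ↔ z.1 = 1 ∨ z.2 = s := by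
  have h : diskCone s z = diskBoundaryInclusion n s ↔
      lineMap z.2.down.1 s.down.1 (z.1 : ℝ) = s.down.1 :=
    ⟨fun h => congrArg (·.down.1) h, fun h => ULift.ext _ _ (Subtype.ext h)⟩
  rw [h, lineMap_eq_right_iff, or_comm]
  exact or_congr (Subtype.ext_iff (a1 := z.1) (a2 := 1)).symm
    ⟨fun h => ULift.ext _ _ (Subtype.ext h), fun h => congrArg (·.down.1) h⟩

theorem injOn_diskCone :
    Set.InjOn (diskCone s) {z | diskCone s z ≠ diskBoundaryInclusion n s} := by
  rintro ⟨t, x⟩ (hz : diskCone s _ ≠ _) ⟨t', x'⟩ (hz' : diskCone s _ ≠ _) h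
  rw [Ne, diskCone_eq_apex_iff, not_or] at hz hz'
  obtain ⟨ht, hx⟩ := eq_and_eq_of_lineMap_eq_lineMap (S := ⟨0, 1⟩) s.down.2 x.down.2 x'.down.2
    (fun hx => hz.2 (ULift.ext _ _ (Subtype.ext hx))) (fun ht => hz.1 (Subtype.ext ht))
    (fun ht => hz'.1 (Subtype.ext ht)) (congrArg (·.down.1) h)
  exact Prod.ext (Subtype.ext ht) (ULift.ext _ _ (Subtype.ext hx))

theorem surjective_diskCone : Function.Surjective (diskCone s) := by
  intro d
  obtain ⟨x, hx, t, ht, hd⟩ :=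
    exists_lineMap_eq_of_dist_le (S := ⟨0, 1⟩) s.down.2 d.down.2
  exact ⟨(⟨t, ht⟩, ⟨⟨x, hx⟩⟩), ULift.ext _ _ (Subtype.ext hd)⟩

end DiskCone

namespace IsSphereCollapse

open ContinuousMap (const)
open TopCat (disk diskBoundary diskBoundaryInclusion)

variable {n : ℕ} {q : C(Fin n → I, diskBoundary.{u} (n + 1))} {s : diskBoundary.{u} (n + 1)}

theorem eq_apex_iff (hq : IsSphereCollapse q s) {y : Fin n → I} :
    q y = s ↔ y ∈ Cube.boundary (Fin n) :=
  ⟨fun hy => by_contra fun h => hq.bijOn.mapsTo h hy, hq.boundary y⟩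

/-- The null-homotopy of the boundary sphere in the disk, parametrized by the cube, that contracts
the sphere along its chords to the base point. -/
noncomputable def coneHomotopy (hq : IsSphereCollapse q s) :
    ((diskBoundaryInclusion (n + 1)).hom.comp q).HomotopyRel
      (const _ (diskBoundaryInclusion (n + 1) s)) (Cube.boundary (Fin n)) where
  toFun z := diskCone s (z.1, q z.2)
  continuous_toFun := by fun_prop
  map_zero_left y := diskCone_zero s (q y)
  map_one_left _ := (diskCone_eq_apex_iff s).2 (Or.inl rfl)
  prop' _ y hy := ((diskCone_eq_apex_iff s).2 (Or.inr (hq.boundary y hy))).trans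
    (congrArg _ (hq.boundary y hy).symm)

theorem coneHomotopy_eq_apex_iff (hq : IsSphereCollapse q s) {z : I × (Fin n → I)} :
    hq.coneHomotopy z = diskBoundaryInclusion (n + 1) s ↔
      z.1 = 1 ∨ z.2 ∈ Cube.boundary (Fin n) :=
  (diskCone_eq_apex_iff s).trans (or_congr_right hq.eq_apex_iff)

theorem injOn_coneHomotopy (hq : IsSphereCollapse q s) :
    Set.InjOn hq.coneHomotopy {z | hq.coneHomotopy z ≠ diskBoundaryInclusion (n + 1) s} := by
  intro z (hz : hq.coneHomotopy z ≠ _) z' (hz' : hq.coneHomotopy z' ≠ _) h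
  obtain ⟨ht, hy⟩ := Prod.ext_iff.1 (injOn_diskCone s hz hz' h)
  rw [Ne, coneHomotopy_eq_apex_iff, not_or] at hz hz'
  exact Prod.ext ht (hq.bijOn.injOn hz.2 hz'.2 hy)

theorem surjective_coneHomotopy (hq : IsSphereCollapse q s) :
    Function.Surjective hq.coneHomotopy := by
  intro d
  obtain ⟨⟨t, x⟩, rfl⟩ := surjective_diskCone s d
  by_cases hx : x = s
  · refine ⟨(1, 0), ?_⟩
    rw [hq.coneHomotopy_eq_apex_iff.2 (Or.inl rfl), (diskCone_eq_apex_iff s).2 (Or.inr hx)]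
  · obtain ⟨y, -, rfl⟩ := hq.bijOn.surjOn hx
    exact ⟨(t, y), rfl⟩

theorem isQuotientMap_coneHomotopy (hq : IsSphereCollapse q s) :
    Topology.IsQuotientMap hq.coneHomotopy := by
  have : T2Space (disk.{u} (n + 1)) := inferInstanceAs <|
    T2Space (ULift (Metric.closedBall (0 : EuclideanSpace ℝ (Fin (n + 1))) 1))
  have hcont : Continuous hq.coneHomotopy := hq.coneHomotopy.continuous
  exact hcont.isClosedMap.isQuotientMap hcont hq.surjective_coneHomotopy

theorem exists_extension_disk (hq : IsSphereCollapse q s) {X : Type*} [TopologicalSpace X] {x₀ : X}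
    (ξ : C(diskBoundary.{u} (n + 1), X)) (hs : ξ s = x₀)
    (W : (ξ.comp q).HomotopyRel (const _ x₀) (Cube.boundary (Fin n))) :
    ∃ ψ : C(disk.{u} (n + 1), X), (∀ z, ψ (hq.coneHomotopy z) = W z) ∧
      ∀ x, ψ (diskBoundaryInclusion (n + 1) x) = ξ x := by
  have hapex : ∀ z, hq.coneHomotopy z = diskBoundaryInclusion (n + 1) s → W z = x₀ := by
    rintro ⟨t, y⟩ hz
    rcases hq.coneHomotopy_eq_apex_iff.1 hz with ht | hy
    · obtain rfl : t = 1 := ht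
      exact W.apply_one y
    · exact (W.eq_fst t hy).trans ((congrArg ξ (hq.boundary y hy)).trans hs)
  have hfactors : Function.FactorsThrough W.toContinuousMap hq.coneHomotopy := by
    intro z z' h
    by_cases hz : hq.coneHomotopy z = diskBoundaryInclusion (n + 1) s
    · exact (hapex z hz).trans (hapex z' (h.symm.trans hz)).symm
    · exact congrArg W (hq.injOn_coneHomotopy hz (fun hz' => hz (h.trans hz')) h)
  let ψ := hq.isQuotientMap_coneHomotopy.lift (f := hq.coneHomotopy.toContinuousMap) _ hfactors
  have hψ : ∀ z, ψ (hq.coneHomotopy z) = W z := fun z =>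
    congrArg (· z) (hq.isQuotientMap_coneHomotopy.lift_comp _ hfactors)
  refine ⟨ψ, hψ, fun x => ?_⟩
  by_cases hx : x = s
  · calc ψ (diskBoundaryInclusion (n + 1) x)
        = ψ (hq.coneHomotopy (1, 0)) := by rw [hx, hq.coneHomotopy.apply_one]; rfl
      _ = ξ x := by rw [hψ, W.apply_one, hx, hs]; rfl
  · obtain ⟨y, -, rfl⟩ := hq.bijOn.surjOn hx
    calc ψ (diskBoundaryInclusion (n + 1) (q y))
        = ψ (hq.coneHomotopy (0, y)) := by rw [hq.coneHomotopy.apply_zero]; rfl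
      _ = ξ (q y) := by rw [hψ, W.apply_zero]; rfl

end IsSphereCollapse

theorem exists_section_of_isPushout {A D B' B E : Type u} [TopologicalSpace A] [TopologicalSpace D]
    [TopologicalSpace B'] [TopologicalSpace B] [TopologicalSpace E] {i : C(A, D)} {φ : C(A, B')}
    {Φ : C(D, B)} {j : C(B', B)}
    (h : IsPushout (TopCat.ofHom i) (TopCat.ofHom φ) (TopCat.ofHom Φ) (TopCat.ofHom j))
    {p : C(E, B)} {ψ : C(D, E)} {τ : C(B', E)} (hψ : ∀ d, p (ψ d) = Φ d)
    (hτ : ∀ b, p (τ b) = j b) (hψτ : ∀ a, ψ (i a) = τ (φ a)) :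
    ∃ s : C(B, E), (∀ b, p (s b) = b) ∧ ∀ b, s (j b) = τ b := by
  let s := h.desc (TopCat.ofHom ψ) (TopCat.ofHom τ) (TopCat.ext hψτ)
  have hsψ : TopCat.ofHom Φ ≫ s = TopCat.ofHom ψ := h.inl_desc _ _ _
  have hsτ : TopCat.ofHom j ≫ s = TopCat.ofHom τ := h.inr_desc _ _ _
  have hs : s ≫ TopCat.ofHom p = 𝟙 _ := by
    refine h.hom_ext ?_ ?_
    · rw [reassoc_of% hsψ, Category.comp_id]
      exact TopCat.ext hψ
    · rw [reassoc_of% hsτ, Category.comp_id]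
      exact TopCat.ext hτ
  exact ⟨s.hom, fun b => congrArg (·.hom b) hs, fun b => congrArg (·.hom b) hsτ⟩

section piMap

variable {n : ℕ} {X Y Z : Type*} [TopologicalSpace X] [TopologicalSpace Y] [TopologicalSpace Z]
  {x : X} {y : Y} {z : Z}

theorem piMap_piMap (f : C(X, Y)) (g : C(Y, Z)) (hf : f x = y) (hg : g y = z) (a : π_ n X x) :
    piMap n g hg (piMap n f hf a) = piMap n (g.comp f) ((congrArg g hf).trans hg) a := by
  induction a using Quotient.inductionOn
  rfl

theorem piMap_piZero (f : C(X, Y)) (hf : f x = y) : piMap n f hf (piZero n x) = piZero n y :=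
  congrArg (Quotient.mk _) (GenLoop.ext _ _ fun _ => hf)

end piMap

namespace PointedFibration

open ContinuousMap (const)
open TopCat (disk diskBoundary diskBoundaryInclusion)

namespace HomotopicallyTrivial

variable {E B : Type*} [TopologicalSpace E] [TopologicalSpace B] {P : PointedFibration E B}
  (r : P.HomotopicallyTrivial) {n : ℕ}

theorem retr_mk_eq_of_homotopicRel {g : GenLoop (Fin n) E P.pt}
    {γ : GenLoop (Fin n) P.Fiber P.fiberPt}
    (h : g.1.HomotopicRel (P.incl.comp γ.1) (Cube.boundary (Fin n))) :
    r.retr n (Quotient.mk _ g) = Quotient.mk _ γ :=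
  (congrArg (r.retr n) (Quotient.sound h)).trans (r.retr_incl n (Quotient.mk _ γ))

theorem exists_lift_nullHomotopy {g : GenLoop (Fin n) E P.pt}
    (hg : r.retr n (Quotient.mk _ g) = piZero n P.fiberPt)
    (K : (P.proj.comp g.1).HomotopyRel (const _ (P.proj P.pt)) (Cube.boundary (Fin n))) :
    ∃ W : g.1.HomotopyRel (const _ P.pt) (Cube.boundary (Fin n)), ∀ z, P.proj (W z) = K z := by
  obtain ⟨g₁, F, hF⟩ := P.isSerreFibration.hasRelHLP_boundary n g.1 _ K
  have hfiber : ∀ y, P.proj (g₁ y) = P.proj P.pt := fun y => by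
    rw [← F.apply_one, hF, K.apply_one]; rfl
  have hboundary : ∀ y ∈ Cube.boundary (Fin n), g₁ y = P.pt := fun y hy => by
    rw [← F.fst_eq_snd hy]
    exact g.2 y hy
  let γ : GenLoop (Fin n) P.Fiber P.fiberPt :=
    ⟨⟨fun y => ⟨g₁ y, hfiber y⟩, by fun_prop⟩, fun y hy => Subtype.ext (hboundary y hy)⟩
  have hγ : Quotient.mk _ γ = piZero n P.fiberPt :=
    (r.retr_mk_eq_of_homotopicRel (γ := γ) ⟨F⟩).symm.trans hg
  obtain ⟨L⟩ : GenLoop.Homotopic γ GenLoop.const := Quotient.exact hγ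
  exact (P.isSerreFibration.hasRelHLP_cylinderBoundary n).exists_lift_trans_vertical K F hF
    (L.compContinuousMap P.incl) fun t y => (L (t, y)).2

theorem exists_lift_disk {q : C(Fin n → I, diskBoundary.{u} (n + 1))}
    {s : diskBoundary.{u} (n + 1)} (hq : IsSphereCollapse q s) (Φ : C(disk.{u} (n + 1), B))
    (ξ : C(diskBoundary.{u} (n + 1), E)) (hs : ξ s = P.pt)
    (hξ : ∀ x, P.proj (ξ x) = Φ (diskBoundaryInclusion (n + 1) x))
    (hr : r.retr n (piMap n ξ hs (Quotient.mk _ (⟨q, hq.boundary⟩ : GenLoop (Fin n) _ s))) =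
      piZero n P.fiberPt) :
    ∃ ψ : C(disk.{u} (n + 1), E), (∀ d, P.proj (ψ d) = Φ d) ∧
      ∀ x, ψ (diskBoundaryInclusion (n + 1) x) = ξ x := by
  obtain ⟨W, hW⟩ := r.exists_lift_nullHomotopy hr <|
    (hq.coneHomotopy.compContinuousMap Φ).cast (ContinuousMap.ext fun y => (hξ (q y)).symm)
      (ContinuousMap.ext fun _ => (hξ s).symm.trans (congrArg P.proj hs))
  obtain ⟨ψ, hψ, hψξ⟩ := hq.exists_extension_disk ξ hs W
  refine ⟨ψ, fun d => ?_, hψξ⟩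
  obtain ⟨z, rfl⟩ := hq.surjective_coneHomotopy d
  exact (congrArg P.proj (hψ z)).trans (hW z)

end HomotopicallyTrivial

theorem HomotopicallyTrivial.exists_section_of_isCellAttachment {E B' B : Type u}
    [TopologicalSpace E] [TopologicalSpace B'] [TopologicalSpace B] {P : PointedFibration E B}
    (r : P.HomotopicallyTrivial) {n : ℕ} {b₀ : B'} {α : π_ n B' b₀}
    {φ : C(diskBoundary.{u} (n + 1), B')} (hφ : RepresentsClass φ α) {j : C(B', B)}
    (hj : IsCellAttachment φ j) (τ : C(B', E)) (hτ : ∀ b, P.proj (τ b) = j b)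
    (hτ₀ : τ b₀ = P.pt) (hα : r.retr n (piMap n τ hτ₀ α) = piZero n P.fiberPt) :
    ∃ s : P.PointedSection, ∀ b, s.toMap (j b) = τ b := by
  obtain ⟨x, q, hq, hx, rfl⟩ := hφ
  obtain ⟨Φ, hΦ⟩ := hj
  obtain ⟨ψ, hψ, hψτ⟩ := r.exists_lift_disk hq Φ (τ.comp φ) _
    (fun x => (hτ (φ x)).trans (congrArg (·.hom x) hΦ.w).symm)
    ((congrArg (r.retr n) (piMap_piMap φ τ hx hτ₀ _)).symm.trans hα)
  obtain ⟨s, hsΦ, hsτ⟩ := exists_section_of_isPushout hΦ hψ hτ hψτ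
  refine ⟨⟨s, hsΦ, ?_⟩, hsτ⟩
  rw [basePt, ← hτ₀, hτ, hsτ]

theorem Hom.IsMorphism.retr_piMap_total_comp_eq_piZero {E' B' E B X : Type*}
    [TopologicalSpace E'] [TopologicalSpace B'] [TopologicalSpace E] [TopologicalSpace B]
    [TopologicalSpace X] {P' : PointedFibration E' B'} {r' : P'.HomotopicallyTrivial}
    {P : PointedFibration E B} {r : P.HomotopicallyTrivial} {f : P'.Hom P}
    (hf : f.IsMorphism r' r) {n : ℕ} {x : X} {g : C(X, E')} {hg : g x = P'.pt} {α : π_ n X x}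
    (h : r'.retr n (piMap n g hg α) = piZero n P'.fiberPt) :
    r.retr n (piMap n (f.total.comp g) ((congrArg f.total hg).trans f.map_pt) α) =
      piZero n P.fiberPt := by
  rw [← piMap_piMap g f.total hg f.map_pt, hf, h, piMap_piZero]

end PointedFibration

theorem mainTheorem6_general {E' : Type*} {B' E B : Type u} [TopologicalSpace E']
    [TopologicalSpace B'] [TopologicalSpace E] [TopologicalSpace B]
    {P' : PointedFibration E' B'} {r' : P'.HomotopicallyTrivial}
    {P : PointedFibration E B} {r : P.HomotopicallyTrivial} {f : P'.Hom P}
    (hf : f.IsMorphism r' r) {n : ℕ} {α : π_ n B' P'.basePt}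
    {φ : C(TopCat.diskBoundary.{u} (n + 1), B')} (hφ : RepresentsClass φ α)
    (hB : IsCellAttachment φ f.base) (s' : P'.PointedSection)
    (hα : r'.retr n (piMap n s'.toMap s'.map_basePt α) = piZero n P'.fiberPt) :
    ∃ s : P.PointedSection, ∀ b, s.toMap (f.base b) = f.total (s'.toMap b) :=
  r.exists_section_of_isCellAttachment hφ hB (f.total.comp s'.toMap)
    (fun b => (f.comm _).trans (congrArg f.base (s'.proj_toMap b))) _
    (hf.retr_piMap_total_comp_eq_piZero hα)

theorem mainTheorem6 {E' B' E B : Type u} [TopologicalSpace E'] [TopologicalSpace B']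
    [TopologicalSpace E] [TopologicalSpace B]
    (P' : PointedFibration E' B') (r' : P'.HomotopicallyTrivial)
    (P : PointedFibration E B) (r : P.HomotopicallyTrivial)
    (f : P'.Hom P) (hf : f.IsSubfibration r' r)
    (n : ℕ) (α : π_ n B' P'.basePt)
    (φ : C(TopCat.diskBoundary.{u} (n + 1), B')) (hφ : RepresentsClass φ α)
    (hB : IsCellAttachment φ f.base)
    (hsec : Nonempty P'.PointedSection)
    (hα : piZero n P'.fiberPt ∈ PointedFibration.bersteinHilton r' α) :
    Nonempty P.PointedSection := by
  obtain ⟨s', hs'⟩ := hα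
  obtain ⟨s, -⟩ := mainTheorem6_general hf.isMorphism hφ hB s' hs'
  exact ⟨s⟩
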